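/- A tree-form decision problem is a finite rooted tree in which every path alternates between observation points (also called sequences) $\sigma\in\Sigma$ and decision points $j\in\mathcal J$, the root $\varnothing$ being an observation point; the children of a decision point $j$ are the observation points $ja$, one for each action $a$ in a finite nonempty set $A_j$, and the children of an observation point are (possibly no) decision points. A sequence-form pure strategy is a vector $x\in\{0,1\}^\Sigma$ for which there is a choice of one action at each decision point such that, for every $\sigma$, $x(\sigma)=1$ if every action on the path from $\varnothing$ to $\sigma$ is chosen and $x(\sigma)=0$ otherwise. Let $\mathcal X\subseteq\mathbb R^\Sigma$ be the set of sequence-form pure strategies and $\operatorname{co}\mathcal X$ its convex hull, the sequence-form polytope. Let $\Phi_{\mathrm{Lin}}$ be the set of linear maps $\phi:\mathcal X\to\operatorname{co}\mathcal X$, that is, of functions on $\mathcal X$ with values in $\operatorname{co}\mathcal X$ that are restrictions of linear maps $\mathbb R^\Sigma\to\mathbb R^\Sigma$, regarded as a subset of the real vector space of all functions $\mathcal X\to\mathbb R^\Sigma$. Let $\hat\Phi_{\mathrm{Lin}}=\{\phi\in\Phi_{\mathrm{Lin}}:\phi(x)\in\mathcal X\text{ for all }x\in\mathcal X\}$. **Corollary.**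 For every tree-form decision problem, the set of extreme points of $\Phi_{\mathrm{Lin}}$ is exactly $\hat\Phi_{\mathrm{Lin}}$, and $\Phi_{\mathrm{Lin}}=\operatorname{co}\hat\Phi_{\mathrm{Lin}}$. -/

import Mathlib

universe u v

/-- A tree-form decision problem with decision points `J` and action sets `A j`.
The observation points (sequences) are the root, `none`, and the points `ja = some ⟨j, a⟩` that
follow an action `a` at a decision point `j`; `parent j` is the observation point immediately
preceding `j`. Well-foundedness says that these parent links form a tree rooted at `none`. -/
structure TreeFormDecisionProblem (J : Type u) (A : J → Type v) where
  parent : J → Option (Σ j, A j)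
  wf : WellFounded fun i j : J => ∃ a : A i, parent j = some ⟨i, a⟩

namespace TreeFormDecisionProblem

variable {J : Type u} {A : J → Type v} (T : TreeFormDecisionProblem J A)

/-- The sequences (observation points), the root being `none`. -/
abbrev Seq (_T : TreeFormDecisionProblem J A) : Type (max u v) := Option (Σ j, A j)

/-- The player who plays the action `s j` at every decision point `j` selects every action
on the path from the root to the given sequence. -/
inductive Plays (s : ∀ j, A j) : Option (Σ j, A j) → Prop
  | root : Plays s none
  | step (j : J) : Plays s (T.parent j) → Plays s (some ⟨j, s j⟩)

/-- The sequence-form vector of the choice `s` of one action per decision point: its entry at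
`σ` is `1` if every action on the path to `σ` is selected, and `0` otherwise. -/
noncomputable def sequenceForm (s : ∀ j, A j) : T.Seq → ℝ :=
  Set.indicator {σ | T.Plays s σ} fun _ => 1

/-- The set `X` of sequence-form pure strategies. -/
def pureStrategies : Set (T.Seq → ℝ) := Set.range T.sequenceForm

/-- The set `co X` of sequence-form mixed strategies. -/
def mixedStrategies : Set (T.Seq → ℝ) := convexHull ℝ T.pureStrategies

/-- The linear maps from `X` to `Y`, as functions on `X`: restrictions to `X` of linear maps of
the ambient space that send every point of `X` into `Y`. -/
def linearMapsInto (Y : Set (T.Seq → ℝ)) : Set (T.pureStrategies → T.Seq → ℝ) :=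
  {φ | (∃ L : (T.Seq → ℝ) →ₗ[ℝ] (T.Seq → ℝ), ∀ x, φ x = L x) ∧ ∀ x, φ x ∈ Y}

/-- `Φ_Lin`, the set of linear maps `X → co X`. -/
def PhiLin : Set (T.pureStrategies → T.Seq → ℝ) := T.linearMapsInto T.mixedStrategies

/-- The set of linear maps `X → X`, which send pure strategies to pure strategies. -/
def PhiLinPure : Set (T.pureStrategies → T.Seq → ℝ) := T.linearMapsInto T.pureStrategies

end TreeFormDecisionProblem

/-!
Let `C` be the matrix of the sequence-form constraints (the entries of `x` at the children of `j`
sum up to its entry at the parent of `j`). Nonnegative vectors `x` with `C x = 0` and `x(∅) = 1`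
form `co X`, and they are integral exactly on `X`. Adding combinations of rows of `C` to the
rows of a matrix does not change the map it induces on `X`, and dynamic programming on the tree
chooses these combinations such that every row becomes nonnegative and vanishes at some action of
every decision point. A map in `Φ_Lin` is thus given by a matrix `M ≥ 0` such that the rows of
`C M` are orthogonal to `X`, which means that `C M = L C` for some `L`; the zeros of `M` force
`L ≥ 0`.

Read entrywise, `C M = L C` is flow conservation on the acyclic directed hypergraph whose vertices
are the pairs of an input sequence `σ` and an output decision point `k`: flow at `(σ, k)` either
queries a decision point below `σ` in the input or plays an action at `k` in the output. A flow
with natural inflow is a convex combination of natural-valued flows, since a linear cost is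
minimized by following an optimal policy, which routes the inflow integrally. Natural-valued flows
encode maps `X → X`, hence `Φ_Lin` is the convex hull of the latter. These are extreme because
pure strategies are vertices of the cube.
-/

theorem wellFounded_swap_of_finite {α : Type*} [Finite α] {r : α → α → Prop}
    (hr : WellFounded r) : WellFounded (Function.swap r) := by
  have : Std.Irrefl (Relation.TransGen (Function.swap r)) :=
    ⟨fun a ha => hr.transGen.irrefl.irrefl a (Relation.transGen_swap.1 ha)⟩
  exact Subrelation.wf Relation.TransGen.single
    (Finite.wellFounded_of_trans_of_irrefl (Relation.TransGen (Function.swap r)))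

theorem mem_convexHull_of_forall_exists_le {V : Type*} [AddCommGroup V] [Module ℝ V]
    [TopologicalSpace V] [IsTopologicalAddGroup V] [ContinuousSMul ℝ V] [LocallyConvexSpace ℝ V]
    [T2Space V] {R : Set V} (hR : R.Finite) {z : V}
    (h : ∀ f : V →L[ℝ] ℝ, ∃ y ∈ R, f y ≤ f z) : z ∈ convexHull ℝ R := by
  by_contra hz
  obtain ⟨f, u, hfz, hfR⟩ := geometric_hahn_banach_point_closed (convex_convexHull ℝ R)
    (hR.isClosed_convexHull ℝ) hz
  obtain ⟨y, hy, hyz⟩ := h f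
  exact (hfz.trans (hfR y (subset_convexHull ℝ R hy))).not_ge hyz

section Hyperflow

variable {S : Type*} {E : S → Type*} {next : (Σ s, E s) → Finset S}

theorem exists_bellman_potential [∀ s, Finite (E s)] [∀ s, Nonempty (E s)]
    (hwf : WellFounded fun t s => ∃ e : E s, t ∈ next ⟨s, e⟩) (c : (Σ s, E s) → ℝ) :
    ∃ v : S → ℝ, (∀ e, v e.1 ≤ c e + ∑ t ∈ next e, v t) ∧
      ∃ p : ∀ s, E s, ∀ s, v s = c ⟨s, p s⟩ + ∑ t ∈ next ⟨s, p s⟩, v t := by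
  let leastCost (s : S) (v : ∀ t, (∃ e : E s, t ∈ next ⟨s, e⟩) → ℝ) : ℝ :=
    ⨅ e : E s, (c ⟨s, e⟩ + ∑ t ∈ (next ⟨s, e⟩).attach, v t ⟨e, t.2⟩)
  let v : S → ℝ := hwf.fix leastCost
  have hv (s : S) : v s = ⨅ e : E s, (c ⟨s, e⟩ + ∑ t ∈ next ⟨s, e⟩, v t) :=
    (hwf.fix_eq leastCost s).trans <|
      iInf_congr fun e => congrArg (c ⟨s, e⟩ + ·) (Finset.sum_attach _ v)
  have hmin (s : S) : ∃ e : E s, v s = c ⟨s, e⟩ + ∑ t ∈ next ⟨s, e⟩, v t := by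
    obtain ⟨e, he⟩ := exists_eq_ciInf_of_finite
      (f := fun e : E s => c ⟨s, e⟩ + ∑ t ∈ next ⟨s, e⟩, v t)
    exact ⟨e, (hv s).trans he.symm⟩
  choose p hp using hmin
  exact ⟨v, fun ⟨s, e⟩ => (hv s).trans_le (ciInf_le (Set.finite_range _).bddBelow e), p, hp⟩

variable [Fintype S] [DecidableEq S] [∀ s, Fintype (E s)]

/-- Flows on the directed hypergraph whose hyperedges out of `s` are the `e : E s`, the hyperedge
`e` having the set of heads `next e`: `z e` units leave `s` along `e`, and as many arrive at each
head of `e`. At every vertex, the flow out is the flow in plus the external inflow `i`. -/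
structure IsHyperflow (next : (Σ s, E s) → Finset S) (i : S → ℝ) (z : (Σ s, E s) → ℝ) : Prop where
  nonneg : 0 ≤ z
  conservation : ∀ s, ∑ e, z ⟨s, e⟩ = i s + ∑ e with s ∈ next e, z e

theorem IsHyperflow.sum_mul_potential_drop {i : S → ℝ} {z : (Σ s, E s) → ℝ}
    (hz : IsHyperflow next i z) (v : S → ℝ) :
    ∑ e, z e * (v e.1 - ∑ t ∈ next e, v t) = ∑ s, i s * v s := by
  have outflow : ∑ e, z e * v e.1 = ∑ s, (∑ e, z ⟨s, e⟩) * v s := by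
    simp only [Fintype.sum_sigma, Finset.sum_mul]
  have inflow : ∑ e, z e * ∑ t ∈ next e, v t = ∑ s, (∑ e with s ∈ next e, z e) * v s := by
    simp only [Finset.mul_sum, Finset.sum_mul]
    exact Finset.sum_comm' (by simp)
  simp only [mul_sub, Finset.sum_sub_distrib, outflow, inflow, hz.conservation, add_mul,
    Finset.sum_add_distrib, add_sub_cancel_right]

theorem exists_nat_hyperflow_of_policy (hwf : WellFounded fun s t => ∃ e : E s, t ∈ next ⟨s, e⟩)
    (i : S → ℕ) (p : ∀ s, E s) :
    ∃ z : (Σ s, E s) → ℕ, IsHyperflow next (fun s => i s) (fun e => z e) ∧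
      ∀ e, z e ≠ 0 → e.2 = p e.1 := by
  classical
  let visitsStep (s : S) (F : ∀ r, (∃ e : E r, s ∈ next ⟨r, e⟩) → ℕ) : ℕ :=
    i s + ∑ r, if h : s ∈ next ⟨r, p r⟩ then F r ⟨p r, h⟩ else 0
  let F : S → ℕ := hwf.fix visitsStep
  have hF (s : S) : F s = i s + ∑ r, if s ∈ next ⟨r, p r⟩ then F r else 0 := by
    simpa only [visitsStep, dite_eq_ite] using hwf.fix_eq visitsStep s
  refine ⟨fun e => if e.2 = p e.1 then F e.1 else 0, ⟨fun e => Nat.cast_nonneg _, fun s => ?_⟩,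
    fun e he => by_contra fun hne => he (if_neg hne)⟩
  have outflow : ∑ e, (if e = p s then F s else 0) = F s := by simp
  have inflow : ∑ e : Σ r, E r with s ∈ next e, (if e.2 = p e.1 then F e.1 else 0) =
      ∑ r, if s ∈ next ⟨r, p r⟩ then F r else 0 := by
    rw [Finset.sum_filter, Fintype.sum_sigma]
    refine Finset.sum_congr rfl fun r _ => ?_
    rw [Fintype.sum_eq_single (p r) fun e he => by simp [he]]
    simp
  exact_mod_cast outflow.trans ((hF s).trans (by rw [inflow]))

theorem IsHyperflow.mem_convexHull_nat [∀ s, Nonempty (E s)]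
    (hwf : WellFounded fun s t => ∃ e : E s, t ∈ next ⟨s, e⟩) {i : S → ℕ} {z : (Σ s, E s) → ℝ}
    (hz : IsHyperflow next (fun s => i s) z) :
    z ∈ convexHull ℝ {y | IsHyperflow next (fun s => i s) y ∧
      ∀ e, y e ∈ (Nat.castRingHom ℝ).rangeS} := by
  classical
  choose y hy hyp using exists_nat_hyperflow_of_policy hwf i
  have hrange : Set.range (fun p e => (y p e : ℝ)) ⊆ {y | IsHyperflow next (fun s => i s) y ∧
      ∀ e, y e ∈ (Nat.castRingHom ℝ).rangeS} := by
    rintro _ ⟨p, rfl⟩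
    exact ⟨hy p, fun e => ⟨y p e, rfl⟩⟩
  refine convexHull_mono hrange
    (mem_convexHull_of_forall_exists_le (Set.finite_range _) fun f => ?_)
  let c (e : Σ s, E s) : ℝ := f fun e' => if e = e' then 1 else 0
  have hf (w : (Σ s, E s) → ℝ) : f w = ∑ e, w e * c e :=
    LinearMap.pi_apply_eq_sum_univ (f : _ →ₗ[ℝ] ℝ) w
  obtain ⟨v, hv, p, hp⟩ := exists_bellman_potential (wellFounded_swap_of_finite hwf) c
  refine ⟨_, ⟨p, rfl⟩, ?_⟩
  calc f (fun e => y p e) = ∑ e, (y p e : ℝ) * (v e.1 - ∑ t ∈ next e, v t) := by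
        rw [hf]
        refine Finset.sum_congr rfl fun e _ => ?_
        rcases eq_or_ne (y p e) 0 with h0 | h0
        · simp [h0]
        · obtain ⟨s, a⟩ := e
          obtain rfl : a = p s := hyp p _ h0
          rw [hp s, add_sub_cancel_right]
    _ = ∑ s, i s * v s := (hy p).sum_mul_potential_drop v
    _ = ∑ e, z e * (v e.1 - ∑ t ∈ next e, v t) := (hz.sum_mul_potential_drop v).symm
    _ ≤ ∑ e, z e * c e := Finset.sum_le_sum fun e _ =>
        mul_le_mul_of_nonneg_left (sub_le_iff_le_add.2 (hv e)) (hz.nonneg e)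
    _ = f z := (hf z).symm

end Hyperflow

theorem eq_single_sum_of_sum_le_one {ι : Type*} [Fintype ι] [DecidableEq ι] [Nonempty ι]
    {f : ι → ℕ} (hf : ∑ i, f i ≤ 1) : ∃ i, f = Pi.single i (∑ k, f k) := by
  by_cases hzero : f = 0
  · exact ⟨Classical.arbitrary ι, by simp [hzero]⟩
  · obtain ⟨i, hi⟩ := Function.ne_iff.1 hzero
    have hoff (k : ι) (hk : k ≠ i) : f k = 0 := by_contra fun hfk =>
      hk (Finset.sum_le_one_iff.1 hf k i (Finset.mem_univ k) (Finset.mem_univ i) hfk hi).1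
    refine ⟨i, funext fun k => ?_⟩
    rw [Fintype.sum_eq_single i hoff]
    obtain rfl | hk := eq_or_ne k i
    · rw [Pi.single_eq_same]
    · rw [hoff k hk, Pi.single_eq_of_ne hk]

namespace TreeFormDecisionProblem

open scoped Matrix

variable {J : Type u} {A : J → Type v} (T : TreeFormDecisionProblem J A)

section PureStrategies

variable {T} in
theorem seq_induction {motive : T.Seq → Prop} (root : motive none)
    (step : ∀ j a, motive (T.parent j) → motive (some ⟨j, a⟩)) (σ : T.Seq) : motive σ := by
  have hsome (j : J) : ∀ a : A j, motive (some ⟨j, a⟩) := by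
    induction j using T.wf.induction with
    | _ j ih =>
    refine fun a => step j a ?_
    rcases hj : T.parent j with _ | ⟨i, b⟩
    · exact root
    · exact ih i ⟨b, hj⟩ b
  rcases σ with _ | ⟨j, a⟩
  · exact root
  · exact hsome j a

theorem plays_some_iff {s : ∀ j, A j} {j : J} {a : A j} :
    T.Plays s (some ⟨j, a⟩) ↔ T.Plays s (T.parent j) ∧ a = s j := by
  constructor
  · rintro ⟨⟩
    exact ⟨‹_›, rfl⟩
  · rintro ⟨h, rfl⟩
    exact .step j h

theorem sequenceForm_none (s : ∀ j, A j) : T.sequenceForm s none = 1 :=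
  Set.indicator_of_mem (s := {σ | T.Plays s σ}) .root _

theorem sequenceForm_some [∀ j, DecidableEq (A j)] (s : ∀ j, A j) (j : J) (a : A j) :
    T.sequenceForm s (some ⟨j, a⟩) = if a = s j then T.sequenceForm s (T.parent j) else 0 := by
  classical
  simp only [sequenceForm, Set.indicator_apply, Set.mem_ofPred_eq, plays_some_iff]
  split_ifs <;> simp_all

theorem sequenceForm_eq_of_forall_some [∀ j, DecidableEq (A j)] {s : ∀ j, A j} {y : T.Seq → ℝ}
    (hnone : y none = 1)
    (hsome : ∀ j a, y (some ⟨j, a⟩) = if a = s j then y (T.parent j) else 0) :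
    T.sequenceForm s = y := by
  refine funext (seq_induction ?_ fun j a ih => ?_)
  · rw [sequenceForm_none, hnone]
  · rw [sequenceForm_some, hsome, ih]

theorem sequenceForm_eq_zero_or_one (s : ∀ j, A j) (σ : T.Seq) :
    T.sequenceForm s σ = 0 ∨ T.sequenceForm s σ = 1 := by
  classical
  rw [sequenceForm, Set.indicator_apply]
  exact (ite_eq_or_eq _ _ _).symm

theorem plays_parent_congr {s s' : ∀ j, A j} {j : J}
    (h : ∀ i, Relation.TransGen (fun i j => ∃ a, T.parent j = some ⟨i, a⟩) i j → s i = s' i) :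
    T.Plays s (T.parent j) ↔ T.Plays s' (T.parent j) := by
  induction j using T.wf.induction with
  | _ j ih =>
  rcases hj : T.parent j with _ | ⟨i, b⟩
  · exact iff_of_true .root .root
  · have hij : ∃ a, T.parent j = some ⟨i, a⟩ := ⟨b, hj⟩
    rw [plays_some_iff, plays_some_iff, ih i hij fun k hk => h k (hk.tail hij), h i (.single hij)]

theorem exists_plays [∀ j, Nonempty (A j)] (σ : T.Seq) : ∃ s, T.Plays s σ := by
  classical
  induction σ using seq_induction with
  | root => exact ⟨fun _ => Classical.arbitrary _, .root⟩
  | step j a ih =>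
    obtain ⟨s, hs⟩ := ih
    have hparent : T.Plays (Function.update s j a) (T.parent j) := by
      refine (T.plays_parent_congr fun i hij => ?_).2 hs
      refine Function.update_of_ne ?_ _ _
      rintro rfl
      exact T.wf.transGen.irrefl.irrefl _ hij
    exact ⟨_, T.plays_some_iff.2 ⟨hparent, by simp⟩⟩

theorem exists_mem_pureStrategies_eq_one [∀ j, Nonempty (A j)] (σ : T.Seq) :
    ∃ x ∈ T.pureStrategies, x σ = 1 := by
  obtain ⟨s, hs⟩ := T.exists_plays σ
  exact ⟨T.sequenceForm s, ⟨s, rfl⟩, Set.indicator_of_mem (s := {σ | T.Plays s σ}) hs _⟩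

theorem pureStrategies_subset_pi_extremePoints :
    T.pureStrategies ⊆ Set.univ.pi fun _ => Set.extremePoints ℝ (Set.Icc 0 1) := by
  rintro _ ⟨s, rfl⟩ σ -
  rw [Set.extremePoints_Icc zero_le_one]
  exact T.sequenceForm_eq_zero_or_one s σ

theorem mixedStrategies_subset_Icc : T.mixedStrategies ⊆ Set.univ.pi fun _ => Set.Icc 0 1 :=
  convexHull_min
    (T.pureStrategies_subset_pi_extremePoints.trans
      (Set.pi_mono fun _ _ => extremePoints_subset))
    (convex_pi fun _ _ => convex_Icc 0 1)

theorem apply_none_of_mem_mixedStrategies {y : T.Seq → ℝ} (hy : y ∈ T.mixedStrategies) :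
    y none = 1 := by
  refine convexHull_min (t := {y : T.Seq → ℝ | y none = 1}) ?_
    (convex_hyperplane (LinearMap.proj none).isLinear 1) hy
  rintro _ ⟨s, rfl⟩
  exact T.sequenceForm_none s

theorem mem_pureStrategies_of_nat [∀ j, Fintype (A j)] [∀ j, Nonempty (A j)] {y : T.Seq → ℕ}
    (hnone : y none = 1) (hy : ∀ j, ∑ a, y (some ⟨j, a⟩) = y (T.parent j)) :
    (fun σ => (y σ : ℝ)) ∈ T.pureStrategies := by
  classical
  have hle (σ : T.Seq) : y σ ≤ 1 := by
    induction σ using seq_induction with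
    | root => exact hnone.le
    | step j a ih =>
      exact (Finset.single_le_sum_of_canonicallyOrdered (f := fun a => y (some ⟨j, a⟩))
        (Finset.mem_univ a)).trans ((hy j).trans_le ih)
  choose s hs using fun j => eq_single_sum_of_sum_le_one ((hy j).trans_le (hle _))
  refine ⟨s, T.sequenceForm_eq_of_forall_some (by simp [hnone]) fun j a => ?_⟩
  have hja := congrFun (hs j) a
  rw [hy, Pi.single_apply] at hja
  rw [hja]
  split_ifs <;> simp

theorem dotProduct_sequenceForm_of_forall_eq_zero [Fintype J] [∀ j, Fintype (A j)]
    {m : T.Seq → ℝ} {s : ∀ j, A j}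
    (hm : ∀ j, m (some ⟨j, s j⟩) = 0) : m ⬝ᵥ T.sequenceForm s = m none := by
  classical
  rw [dotProduct, Fintype.sum_eq_single none, sequenceForm_none, mul_one]
  rintro (_ | ⟨j, a⟩) hne
  · exact absurd rfl hne
  · rw [sequenceForm_some]
    split_ifs with ha
    · rw [ha, hm, zero_mul]
    · exact mul_zero _

end PureStrategies

section ExtremePoints

theorem PhiLinPure_subset_PhiLin : T.PhiLinPure ⊆ T.PhiLin :=
  fun _ hφ => ⟨hφ.1, fun x => subset_convexHull ℝ _ (hφ.2 x)⟩

theorem convex_PhiLin : Convex ℝ T.PhiLin := by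
  rintro φ ⟨⟨L, hL⟩, hφ⟩ ψ ⟨⟨M, hM⟩, hψ⟩ a b ha hb hab
  exact ⟨⟨a • L + b • M, fun x => by simp [hL, hM]⟩,
    fun x => convex_convexHull ℝ _ (hφ x) (hψ x) ha hb hab⟩

theorem PhiLinPure_subset_extremePoints : T.PhiLinPure ⊆ Set.extremePoints ℝ T.PhiLin := by
  let cube : Set (T.pureStrategies → T.Seq → ℝ) :=
    Set.univ.pi fun _ => Set.univ.pi fun _ => Set.Icc 0 1
  have hcube : T.PhiLin ⊆ cube := fun φ hφ x _ => T.mixedStrategies_subset_Icc (hφ.2 x)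
  refine fun φ hφ => inter_extremePoints_subset_extremePoints_of_subset hcube
    ⟨T.PhiLinPure_subset_PhiLin hφ, ?_⟩
  simp only [cube, extremePoints_pi]
  exact fun x _ => T.pureStrategies_subset_pi_extremePoints (hφ.2 x)

end ExtremePoints

section Constraints

variable [DecidableEq J] [∀ j, DecidableEq (A j)] [Fintype J]

/-- The decision points immediately below an observation point. -/
def children (σ : T.Seq) : Finset J := {t | T.parent t = σ}

@[simp]
theorem mem_children {σ : T.Seq} {t : J} : t ∈ T.children σ ↔ T.parent t = σ := by
  simp [children]

/-- The matrix of the sequence-form constraints: row `j` of `T.constraintMatrix *ᵥ y = 0` says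
that the entries of `y` at the sequences `ja` sum up to its entry at the parent of `j`. -/
def constraintMatrix [∀ j, Fintype (A j)] : Matrix J T.Seq ℝ :=
  fun j => Pi.single (T.parent j) 1 - ∑ a, Pi.single (some ⟨j, a⟩) 1

variable [∀ j, Fintype (A j)]

theorem constraintMatrix_mulVec_apply (y : T.Seq → ℝ) (j : J) :
    (T.constraintMatrix *ᵥ y) j = y (T.parent j) - ∑ a, y (some ⟨j, a⟩) := by
  change (Pi.single (T.parent j) 1 - ∑ a, Pi.single (some ⟨j, a⟩) 1) ⬝ᵥ y = _
  simp only [sub_dotProduct, sum_dotProduct, single_one_dotProduct]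

theorem vecMul_constraintMatrix_apply (l : J → ℝ) (σ : T.Seq) :
    (l ᵥ* T.constraintMatrix) σ = ∑ t ∈ T.children σ, l t - σ.elim 0 fun e => l e.1 := by
  have hlast : ∑ t, l t * (∑ a, Pi.single (some ⟨t, a⟩) 1 : T.Seq → ℝ) σ =
      σ.elim 0 fun e => l e.1 := by
    simp only [Finset.sum_apply, Finset.mul_sum, ← Fintype.sum_sigma']
    rcases σ with _ | e <;> simp [Pi.single_apply]
  simp only [Matrix.vecMul, dotProduct, constraintMatrix, Pi.sub_apply, mul_sub,
    Finset.sum_sub_distrib, hlast]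
  simp [children, Finset.sum_filter, Pi.single_apply, eq_comm]

theorem constraintMatrix_mulVec_sequenceForm (s : ∀ j, A j) :
    T.constraintMatrix *ᵥ T.sequenceForm s = 0 := by
  ext j
  simp [constraintMatrix_mulVec_apply, sequenceForm_some]

theorem constraintMatrix_mulVec_eq_zero {y : T.Seq → ℝ} (hy : y ∈ T.mixedStrategies) :
    T.constraintMatrix *ᵥ y = 0 := by
  have hconv : Convex ℝ {y | T.constraintMatrix *ᵥ y = 0} :=
    (LinearMap.ker T.constraintMatrix.mulVecLin).convex
  refine convexHull_min ?_ hconv hy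
  rintro _ ⟨s, rfl⟩
  exact T.constraintMatrix_mulVec_sequenceForm s

theorem mem_pureStrategies_of_constraintMatrix_mulVec_eq_zero [∀ j, Nonempty (A j)]
    {y : T.Seq → ℝ} (hint : ∀ σ, y σ ∈ (Nat.castRingHom ℝ).rangeS) (hnone : y none = 1)
    (hy : T.constraintMatrix *ᵥ y = 0) : y ∈ T.pureStrategies := by
  choose n hn using hint
  obtain rfl : (fun σ => (n σ : ℝ)) = y := funext hn
  refine T.mem_pureStrategies_of_nat (Nat.cast_eq_one.1 hnone) fun j => ?_
  have hj := congrFun hy j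
  rw [constraintMatrix_mulVec_apply, Pi.zero_apply, sub_eq_zero] at hj
  exact_mod_cast hj.symm

theorem add_vecMul_constraintMatrix_dotProduct (c : T.Seq → ℝ) (l : J → ℝ) {x : T.Seq → ℝ}
    (hx : x ∈ T.pureStrategies) : (c + l ᵥ* T.constraintMatrix) ⬝ᵥ x = c ⬝ᵥ x := by
  rw [add_dotProduct, ← Matrix.dotProduct_mulVec,
    T.constraintMatrix_mulVec_eq_zero (subset_convexHull ℝ _ hx), dotProduct_zero, add_zero]

theorem exists_add_vecMul_constraintMatrix_nonneg [∀ j, Nonempty (A j)] {c : T.Seq → ℝ}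
    (hc : ∀ x ∈ T.pureStrategies, 0 ≤ c ⬝ᵥ x) :
    ∃ l : J → ℝ, 0 ≤ c + l ᵥ* T.constraintMatrix ∧
      ∀ j, ∃ a, (c + l ᵥ* T.constraintMatrix) (some ⟨j, a⟩) = 0 := by
  obtain ⟨l, hl, s, hs⟩ := exists_bellman_potential (next := fun e => T.children (some e))
    (by simpa only [mem_children] using wellFounded_swap_of_finite T.wf) (fun e => c (some e))
  have hsome (e : Σ j, A j) : (c + l ᵥ* T.constraintMatrix) (some e) =
      c (some e) + ∑ t ∈ T.children (some e), l t - l e.1 := by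
    rw [Pi.add_apply, vecMul_constraintMatrix_apply, Option.elim_some, add_sub_assoc]
  have hzero (j : J) : (c + l ᵥ* T.constraintMatrix) (some ⟨j, s j⟩) = 0 := by
    rw [hsome, ← hs j, sub_self]
  refine ⟨l, ?_, fun j => ⟨s j, hzero j⟩⟩
  rintro (_ | e)
  · have hx : T.sequenceForm s ∈ T.pureStrategies := ⟨s, rfl⟩
    rw [← T.dotProduct_sequenceForm_of_forall_eq_zero hzero,
      T.add_vecMul_constraintMatrix_dotProduct c l hx]
    exact hc _ hx
  · rw [hsome]
    exact sub_nonneg.2 (hl e)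

theorem exists_eq_vecMul_constraintMatrix [∀ j, Nonempty (A j)] {c : T.Seq → ℝ}
    (hc : ∀ x ∈ T.pureStrategies, c ⬝ᵥ x = 0) : ∃ l, c = l ᵥ* T.constraintMatrix := by
  obtain ⟨l, hl, -⟩ := T.exists_add_vecMul_constraintMatrix_nonneg fun x hx => (hc x hx).ge
  refine ⟨-l, ?_⟩
  rw [Matrix.neg_vecMul, eq_neg_iff_add_eq_zero]
  ext σ
  obtain ⟨x, hx, hxσ⟩ := T.exists_mem_pureStrategies_eq_one σ
  have hx0 : 0 ≤ x := fun τ =>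
    (T.mixedStrategies_subset_Icc (subset_convexHull ℝ _ hx) τ trivial).1
  have hsum : (c + l ᵥ* T.constraintMatrix) ⬝ᵥ x = 0 := by
    rw [T.add_vecMul_constraintMatrix_dotProduct c l hx, hc x hx]
  have hσ := (Fintype.sum_eq_zero_iff_of_nonneg fun τ => mul_nonneg (hl τ) (hx0 τ)).1 hsum
  simpa [hxσ] using congrFun hσ σ

theorem nonneg_of_vecMul_constraintMatrix_nonpos {l : J → ℝ}
    (hl : ∀ j, ∃ a, (l ᵥ* T.constraintMatrix) (some ⟨j, a⟩) ≤ 0) : 0 ≤ l := by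
  intro j
  induction j using (wellFounded_swap_of_finite T.wf).induction with
  | _ j ih =>
  obtain ⟨a, ha⟩ := hl j
  rw [vecMul_constraintMatrix_apply, Option.elim_some, sub_nonpos] at ha
  exact (Finset.sum_nonneg fun t ht => ih t ⟨a, T.mem_children.1 ht⟩).trans ha

end Constraints

section Intertwiners

variable [DecidableEq J] [∀ j, DecidableEq (A j)] [∀ j, Fintype (A j)] [Fintype J]

/-- Certificates that `M` maps mixed strategies to mixed strategies: since `M` is nonnegative,
fixes the entry at the root and satisfies `C M = L C` for the constraint matrix `C`, it preserves
the polytope of nonnegative solutions of the constraints. The multiplier `L` is also required to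
be nonnegative, so that `M` and `L` together form a flow. -/
structure IsNonnegIntertwiner (M : Matrix T.Seq T.Seq ℝ) (L : Matrix J J ℝ) : Prop where
  matrix_nonneg : ∀ τ σ, 0 ≤ M τ σ
  multiplier_nonneg : ∀ k j, 0 ≤ L k j
  row_none : M none = Pi.single none 1
  constraintMatrix_mul : T.constraintMatrix * M = L * T.constraintMatrix

variable {T}

theorem IsNonnegIntertwiner.mulVec_mem_PhiLinPure [∀ j, Nonempty (A j)]
    {M : Matrix T.Seq T.Seq ℝ} {L : Matrix J J ℝ} (h : T.IsNonnegIntertwiner M L)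
    (hM : ∀ τ σ, M τ σ ∈ (Nat.castRingHom ℝ).rangeS) :
    (fun x : T.pureStrategies => M *ᵥ x) ∈ T.PhiLinPure := by
  refine ⟨⟨M.mulVecLin, fun x => rfl⟩, ?_⟩
  rintro ⟨_, s, rfl⟩
  refine T.mem_pureStrategies_of_constraintMatrix_mulVec_eq_zero (fun τ => ?_) ?_ ?_
  · refine sum_mem fun σ _ => mul_mem (hM τ σ) ?_
    rcases T.sequenceForm_eq_zero_or_one s σ with h0 | h1
    · simpa only [h0] using zero_mem _
    · simpa only [h1] using one_mem _
  · simp [Matrix.mulVec, h.row_none, sequenceForm_none]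
  · rw [Matrix.mulVec_mulVec, h.constraintMatrix_mul, ← Matrix.mulVec_mulVec,
      constraintMatrix_mulVec_sequenceForm, Matrix.mulVec_zero]

theorem exists_reduced_matrix_of_mem_PhiLin [∀ j, Nonempty (A j)]
    {φ : T.pureStrategies → T.Seq → ℝ} (hφ : φ ∈ T.PhiLin) :
    ∃ M : Matrix T.Seq T.Seq ℝ, (∀ τ σ, 0 ≤ M τ σ) ∧ M none = Pi.single none 1 ∧
      (∀ τ j, ∃ a, M τ (some ⟨j, a⟩) = 0) ∧ ∀ x, φ x = M *ᵥ x := by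
  obtain ⟨⟨N, hN⟩, hmixed⟩ := hφ
  have hNx (x : T.pureStrategies) : φ x = LinearMap.toMatrix' N *ᵥ x := by
    rw [hN, LinearMap.toMatrix'_mulVec]
  have hrow_nonneg (e : Σ j, A j) (x) (hx : x ∈ T.pureStrategies) :
      0 ≤ LinearMap.toMatrix' N (some e) ⬝ᵥ x :=
    (T.mixedStrategies_subset_Icc (hmixed ⟨x, hx⟩) (some e) trivial).1.trans_eq
      (congrFun (hNx ⟨x, hx⟩) _)
  choose l hl hzero using fun e => T.exists_add_vecMul_constraintMatrix_nonneg (hrow_nonneg e)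
  let M : Matrix T.Seq T.Seq ℝ
    | none => Pi.single none 1
    | some e => LinearMap.toMatrix' N (some e) + l e ᵥ* T.constraintMatrix
  refine ⟨M, ?_, rfl, ?_, fun x => funext ?_⟩
  · rintro (_ | e) σ
    · exact (Pi.single_nonneg.2 zero_le_one : (0 : T.Seq → ℝ) ≤ Pi.single none 1) σ
    · exact hl e σ
  · rintro (_ | e) j
    · exact ⟨Classical.arbitrary _, Pi.single_eq_of_ne (by simp) _⟩
    · exact hzero e j
  · rintro (_ | e)
    · have hx := T.apply_none_of_mem_mixedStrategies (subset_convexHull ℝ _ x.2)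
      rw [T.apply_none_of_mem_mixedStrategies (hmixed x), Matrix.mulVec, single_one_dotProduct, hx]
    · rw [hNx]
      exact (T.add_vecMul_constraintMatrix_dotProduct _ (l e) x.2).symm

theorem exists_isNonnegIntertwiner_of_mem_PhiLin [∀ j, Nonempty (A j)]
    {φ : T.pureStrategies → T.Seq → ℝ} (hφ : φ ∈ T.PhiLin) :
    ∃ M L, T.IsNonnegIntertwiner M L ∧ φ = fun x : T.pureStrategies => M *ᵥ x := by
  obtain ⟨M, hM, hnone, hzero, hMx⟩ := exists_reduced_matrix_of_mem_PhiLin hφ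
  have hvanish (k : J) (x) (hx : x ∈ T.pureStrategies) : (T.constraintMatrix * M) k ⬝ᵥ x = 0 := by
    change ((T.constraintMatrix * M) *ᵥ x) k = 0
    rw [← Matrix.mulVec_mulVec, ← hMx ⟨x, hx⟩,
      T.constraintMatrix_mulVec_eq_zero (hφ.2 ⟨x, hx⟩), Pi.zero_apply]
  choose L hL using fun k => T.exists_eq_vecMul_constraintMatrix (hvanish k)
  refine ⟨M, L, ⟨hM, fun k => ?_, hnone, funext hL⟩, funext hMx⟩
  refine T.nonneg_of_vecMul_constraintMatrix_nonpos fun j => ?_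
  obtain ⟨a, ha⟩ := hzero (T.parent k) j
  refine ⟨a, ?_⟩
  rw [← hL k]
  change (T.constraintMatrix *ᵥ fun τ => M τ (some ⟨j, a⟩)) k ≤ 0
  rw [constraintMatrix_mulVec_apply, ha, zero_sub, neg_nonpos]
  exact Finset.sum_nonneg fun b _ => hM _ _

end Intertwiners

section MapFlows

/-- The hyperedges out of the vertex `(σ, k)`, which stands for the input having been revealed
up to `σ` and the output waiting for an action at `k`: either query a decision point below `σ`,
or play an action at `k`. -/
abbrev MapMove (s : T.Seq × J) : Type _ := {j // T.parent j = s.1} ⊕ A s.2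

theorem wellFounded_seq :
    WellFounded fun σ τ : T.Seq => ∃ j a, τ = some ⟨j, a⟩ ∧ T.parent j = σ := by
  refine ⟨seq_induction ⟨_, ?_⟩ fun j a ih => ⟨_, ?_⟩⟩
  · rintro σ ⟨j, a, h, -⟩
    cases h
  · rintro σ ⟨j', a', h, rfl⟩
    cases h
    exact ih

variable [DecidableEq J] [∀ j, DecidableEq (A j)]

section Encoding

variable {T}

/-- The matrix of the map encoded by a flow: its entry at `(ka, σ)` is the flow along the action
`a` at `(σ, k)`. -/
def flowMatrix (z : (Σ s, T.MapMove s) → ℝ) : Matrix T.Seq T.Seq ℝ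
  | none => Pi.single none 1
  | some e => fun σ => z ⟨(σ, e.1), .inr e.2⟩

/-- The multiplier of `flowMatrix z`: its entry at `(k, j)` is the flow along the query of `j`
while the output is waiting at `k`. -/
def flowMultiplier (z : (Σ s, T.MapMove s) → ℝ) : Matrix J J ℝ :=
  fun k j => z ⟨(T.parent j, k), .inl ⟨j, rfl⟩⟩

theorem exists_flow {M : Matrix T.Seq T.Seq ℝ} (hM : M none = Pi.single none 1)
    (L : Matrix J J ℝ) :
    ∃ z : (Σ s, T.MapMove s) → ℝ, flowMatrix z = M ∧ flowMultiplier z = L := by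
  let z : (Σ s, T.MapMove s) → ℝ
    | ⟨s, .inl j⟩ => L s.2 j
    | ⟨s, .inr a⟩ => M (some ⟨s.2, a⟩) s.1
  refine ⟨z, ?_, rfl⟩
  funext τ
  rcases τ with _ | e
  · exact hM.symm
  · rfl

theorem flowMatrix_smul_add_smul (y z : (Σ s, T.MapMove s) → ℝ) {a b : ℝ} (hab : a + b = 1) :
    flowMatrix (a • y + b • z) = a • flowMatrix y + b • flowMatrix z := by
  funext τ
  rcases τ with _ | e
  · exact (Convex.combo_self hab _).symm
  · rfl

theorem flow_nonneg_iff {z : (Σ s, T.MapMove s) → ℝ} :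
    0 ≤ z ↔ (∀ τ σ, 0 ≤ flowMatrix z τ σ) ∧ ∀ k j, 0 ≤ flowMultiplier z k j := by
  constructor
  · refine fun hz => ⟨?_, fun k j => hz _⟩
    rintro (_ | e) σ
    · exact (Pi.single_nonneg.2 zero_le_one : (0 : T.Seq → ℝ) ≤ Pi.single none 1) σ
    · exact hz _
  · rintro ⟨hM, hL⟩ ⟨⟨σ, k⟩, ⟨j, hj : T.parent j = σ⟩ | a⟩
    · subst hj
      exact hL k j
    · exact hM (some ⟨k, a⟩) σ

end Encoding

variable [∀ j, Fintype (A j)] [Fintype J]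

/-- The heads of the hyperedges: a query of `j` may be answered by any action at `j`, and after an
action the output continues at every decision point below it. -/
def mapNext : (Σ s, T.MapMove s) → Finset (T.Seq × J)
  | ⟨s, .inl j⟩ => Finset.univ.image fun a => (some ⟨j.1, a⟩, s.2)
  | ⟨s, .inr a⟩ => (T.children (some ⟨s.2, a⟩)).image fun t => (s.1, t)

/-- One unit of flow enters at `(none, k)` for each output decision point `k` at the root. -/
def mapInflow (s : T.Seq × J) : ℕ := if s.1 = none ∧ T.parent s.2 = none then 1 else 0

theorem wellFounded_mapNext : WellFounded fun s t => ∃ e, t ∈ T.mapNext ⟨s, e⟩ := by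
  refine Subrelation.wf ?_ (WellFounded.prod_gameAdd T.wellFounded_seq T.wf)
  rintro ⟨σ, k⟩ t ⟨⟨j, hj⟩ | a, ht⟩
  · obtain ⟨a, -, rfl⟩ := Finset.mem_image.1 ht
    exact Prod.GameAdd.fst ⟨j, a, rfl, hj⟩
  · obtain ⟨t, hat, rfl⟩ := Finset.mem_image.1 ht
    exact Prod.GameAdd.snd ⟨a, T.mem_children.1 hat⟩

variable {T}

theorem sum_mapMove (z : (Σ s, T.MapMove s) → ℝ) (σ : T.Seq) (k : J) :
    ∑ e, z ⟨(σ, k), e⟩ =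
      ∑ t ∈ T.children σ, flowMultiplier z k t + ∑ a, flowMatrix z (some ⟨k, a⟩) σ := by
  rw [Fintype.sum_sum_type, Finset.sum_subtype (T.children σ) fun t => T.mem_children]
  refine congrArg (· + _) (Fintype.sum_congr _ _ ?_)
  rintro ⟨j, hj : T.parent j = σ⟩
  subst hj
  rfl

theorem sum_sigma_mapMove (f : (Σ s, T.MapMove s) → ℝ) :
    ∑ e, f e = ∑ k, ∑ j, f ⟨(T.parent j, k), .inl ⟨j, rfl⟩⟩ +
      ∑ e : Σ k, A k, ∑ σ, f ⟨(σ, e.1), .inr e.2⟩ := by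
  simp only [Fintype.sum_sigma, Fintype.sum_prod_type_right, Fintype.sum_sum_type,
    Finset.sum_add_distrib]
  refine congrArg₂ (· + ·) (Fintype.sum_congr _ _ fun k => ?_)
    (Fintype.sum_congr _ _ fun k => Finset.sum_comm (t := (Finset.univ : Finset (A k))))
  rw [← Fintype.sum_fiberwise T.parent]
  refine Fintype.sum_congr _ _ fun σ => Fintype.sum_congr _ _ ?_
  rintro ⟨j, rfl⟩
  rfl

theorem sum_queries_into (L : Matrix J J ℝ) (σ : T.Seq) (k : J) :
    ∑ l, ∑ j, (if (σ, k) ∈ T.mapNext ⟨(T.parent j, l), .inl ⟨j, rfl⟩⟩ then L l j else 0) =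
      σ.elim 0 fun e => L k e.1 := by
  rcases σ with _ | ⟨i, b⟩
  · simp [mapNext]
  · have hmem (l j : J) :
        (some ⟨i, b⟩, k) ∈ T.mapNext ⟨(T.parent j, l), .inl ⟨j, rfl⟩⟩ ↔ l = k ∧ j = i := by
      simp only [mapNext, Finset.mem_image, Finset.mem_univ, true_and, Prod.mk.injEq,
        Option.some.injEq]
      constructor
      · rintro ⟨a, ⟨⟩, rfl⟩
        exact ⟨rfl, rfl⟩
      · rintro ⟨rfl, rfl⟩
        exact ⟨b, rfl, rfl⟩
    simp [hmem, ite_and]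

theorem mapInflow_add_sum_actions_into {M : Matrix T.Seq T.Seq ℝ}
    (hM : M none = Pi.single none 1) (σ : T.Seq) (k : J) :
    T.mapInflow (σ, k) + ∑ e : Σ l, A l, ∑ τ,
      (if (σ, k) ∈ T.mapNext ⟨(τ, e.1), .inr e.2⟩ then M (some e) τ else 0) =
        M (T.parent k) σ := by
  have hmem (e : Σ l, A l) (τ : T.Seq) :
      (σ, k) ∈ T.mapNext ⟨(τ, e.1), .inr e.2⟩ ↔ τ = σ ∧ T.parent k = some e := by
    simp [mapNext, and_comm]
  simp only [hmem, ite_and, Finset.sum_ite_eq', Finset.mem_univ, if_true, mapInflow]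
  rcases T.parent k with _ | e
  · simp [hM, Pi.single_apply]
  · simp

theorem mapInflow_add_sum_mem_mapNext (z : (Σ s, T.MapMove s) → ℝ) (σ : T.Seq) (k : J) :
    T.mapInflow (σ, k) + ∑ e with (σ, k) ∈ T.mapNext e, z e =
      (σ.elim 0 fun e => flowMultiplier z k e.1) + flowMatrix z (T.parent k) σ := by
  rw [← sum_queries_into, ← mapInflow_add_sum_actions_into (M := flowMatrix z) rfl,
    Finset.sum_filter, sum_sigma_mapMove, add_left_comm]
  rfl

theorem constraintMatrix_mul_eq_mul_iff {M : Matrix T.Seq T.Seq ℝ} {L : Matrix J J ℝ} :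
    T.constraintMatrix * M = L * T.constraintMatrix ↔
      ∀ σ k, ∑ t ∈ T.children σ, L k t + ∑ a, M (some ⟨k, a⟩) σ =
        (σ.elim 0 fun e => L k e.1) + M (T.parent k) σ := by
  have entry (k : J) (σ : T.Seq) : (T.constraintMatrix * M) k σ = (L * T.constraintMatrix) k σ ↔
      ∑ t ∈ T.children σ, L k t + ∑ a, M (some ⟨k, a⟩) σ =
        (σ.elim 0 fun e => L k e.1) + M (T.parent k) σ := by
    change (T.constraintMatrix *ᵥ fun τ => M τ σ) k = (L k ᵥ* T.constraintMatrix) σ ↔ _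
    rw [constraintMatrix_mulVec_apply, vecMul_constraintMatrix_apply]
    constructor <;> intro h <;> linarith
  simp only [← Matrix.ext_iff, entry]
  exact forall_comm

theorem isHyperflow_mapNext_iff {z : (Σ s, T.MapMove s) → ℝ} :
    IsHyperflow T.mapNext (fun s => T.mapInflow s) z ↔
      T.IsNonnegIntertwiner (flowMatrix z) (flowMultiplier z) := by
  have hcons : (∀ s, ∑ e, z ⟨s, e⟩ = T.mapInflow s + ∑ e with s ∈ T.mapNext e, z e) ↔
      T.constraintMatrix * flowMatrix z = flowMultiplier z * T.constraintMatrix := by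
    simp only [Prod.forall, sum_mapMove, mapInflow_add_sum_mem_mapNext,
      constraintMatrix_mul_eq_mul_iff]
  constructor
  · rintro ⟨hz, hflow⟩
    obtain ⟨hM, hL⟩ := flow_nonneg_iff.1 hz
    exact ⟨hM, hL, rfl, hcons.1 hflow⟩
  · rintro ⟨hM, hL, -, hmul⟩
    exact ⟨flow_nonneg_iff.2 ⟨hM, hL⟩, hcons.2 hmul⟩

theorem flowMatrix_mulVec_mem_convexHull_PhiLinPure [∀ j, Nonempty (A j)]
    {z : (Σ s, T.MapMove s) → ℝ} (hz : IsHyperflow T.mapNext (fun s => T.mapInflow s) z) :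
    (fun x : T.pureStrategies => flowMatrix z *ᵥ x) ∈ convexHull ℝ T.PhiLinPure := by
  let toMap (y : (Σ s, T.MapMove s) → ℝ) (x : T.pureStrategies) : T.Seq → ℝ := flowMatrix y *ᵥ x
  have hconvex : Convex ℝ (toMap ⁻¹' convexHull ℝ T.PhiLinPure) := by
    intro y hy w hw a b ha hb hab
    have hcomb : toMap (a • y + b • w) = a • toMap y + b • toMap w := by
      funext x
      simp only [toMap, flowMatrix_smul_add_smul y w hab, Matrix.add_mulVec, Matrix.smul_mulVec,
        Pi.add_apply, Pi.smul_apply]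
    rw [Set.mem_preimage, hcomb]
    exact convex_convexHull ℝ _ hy hw ha hb hab
  refine convexHull_min ?_ hconvex (hz.mem_convexHull_nat T.wellFounded_mapNext)
  rintro y ⟨hy, hint⟩
  refine subset_convexHull ℝ _
    ((isHyperflow_mapNext_iff.1 hy).mulVec_mem_PhiLinPure fun τ σ => ?_)
  rcases τ with _ | e
  · rw [flowMatrix, Pi.single_apply]
    split_ifs
    exacts [one_mem _, zero_mem _]
  · exact hint _

end MapFlows

theorem PhiLin_eq_convexHull_PhiLinPure [Finite J] [∀ j, Finite (A j)] [∀ j, Nonempty (A j)] :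
    T.PhiLin = convexHull ℝ T.PhiLinPure := by
  classical
  have := Fintype.ofFinite J
  have (j : J) := Fintype.ofFinite (A j)
  refine Set.Subset.antisymm (fun φ hφ => ?_)
    (convexHull_min T.PhiLinPure_subset_PhiLin T.convex_PhiLin)
  obtain ⟨M, L, hML, rfl⟩ := exists_isNonnegIntertwiner_of_mem_PhiLin hφ
  obtain ⟨z, rfl, rfl⟩ := exists_flow hML.row_none L
  exact flowMatrix_mulVec_mem_convexHull_PhiLinPure (isHyperflow_mapNext_iff.2 hML)

end TreeFormDecisionProblem

theorem mainTheorem5 {J : Type u} {A : J → Type v} [Finite J] [∀ j, Finite (A j)]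
    [∀ j, Nonempty (A j)] (T : TreeFormDecisionProblem J A) :
    Set.extremePoints ℝ T.PhiLin = T.PhiLinPure ∧
      T.PhiLin = convexHull ℝ T.PhiLinPure := by
  refine ⟨Set.Subset.antisymm ?_ T.PhiLinPure_subset_extremePoints,
    T.PhiLin_eq_convexHull_PhiLinPure⟩
  rw [T.PhiLin_eq_convexHull_PhiLinPure]
  exact extremePoints_convexHull_subset
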